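/- **Conventions.** For a non-empty set $S\subset\mathbb R^2_{\ge 0}$ let $\Gamma_+(S)=\operatorname{conv}(S)+\mathbb R^2_{\ge 0}$; the diagram of $S$ is the union of the compact faces of $\Gamma_+(S)$ (its boundary without the two half-lines parallel to the axes). A *Newton diagram* is the diagram of a non-empty set of points of $\mathbb Z^2_{\ge 0}\setminus\{(0,0)\}$ (a single vertex is allowed). A *deformation* of a Newton diagram $D$ is the diagram of $D\cup P$ for some set $P\subset\mathbb Z^2_{\ge 0}\setminus\{(0,0)\}$. The *Newton number* of a diagram $D$ that meets both coordinate axes, at $(a,0)$ and $(0,b)$, is $\nu(D)=2A-a-b+1$, where $A$ is the area of $\mathbb R^2_{\ge 0}\setminus\Gamma_+(D)$; for a diagram that misses an axis, $\nu(D)$ is the supremum over $m\ge 1$ of the Newton numbers obtained after adding to $D$ the point at distance $m$ from the origin on each missed axis. For positive integers $p,q$ let $\operatorname{tr}(p,q)$ be the segment with end-points $(0,q)$ and $(p,0)$. **Theorem.** Let $p\ge 2$ and $k\ge 1$ be integers. The Newton number $\nu=\nu(\operatorname{tr}(p,kp))$ is a non-negative integer. Let $D$ be any Newton diagram contained, as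 a subset of the plane, in the segment $\operatorname{tr}(p,kp)$. Then every integer $n$ with $1\le n\le\nu$ is the Newton number of some deformation of $D$, except possibly * the integers $n$ with $\nu-(p-1)<n<\nu$, and * the integer $n=\nu-(2p-1)$, if $p$ is even. -/

import Mathlib

open MeasureTheory
open scoped Pointwise

noncomputable section

namespace NewtonDiagram

/-- The points of the lattice `ℤ²` in the closed non-negative quadrant other than the origin, i.e.
the exponents of the monomials that may occur in a power series vanishing at the origin. -/
def exponents : Set (ℝ × ℝ) :=
  {z | ∃ a b : ℕ, z = ((a : ℝ), (b : ℝ)) ∧ z ≠ 0}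

/-- The Newton polyhedron of `S`: the convex hull of `S` plus the closed non-negative quadrant. -/
def polyhedron (S : Set (ℝ × ℝ)) : Set (ℝ × ℝ) :=
  convexHull ℝ S + Set.Ici 0

/-- The Newton diagram of `S`, as a subset of the plane: the boundary of the Newton polyhedron
without its two half-lines parallel to the axes (their end-points are kept). These are the points
of the polyhedron that are minimal for the coordinatewise order, that is, the union of the compact
faces. -/
def diagram (S : Set (ℝ × ℝ)) : Set (ℝ × ℝ) :=
  {z | Minimal (fun w => w ∈ polyhedron S) z}

/-- `D` is a Newton diagram: the diagram of some non-empty set of exponents (the support of a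
non-zero power series vanishing at the origin). -/
def IsNewtonDiagram (D : Set (ℝ × ℝ)) : Prop :=
  ∃ A : Set (ℝ × ℝ), A ⊆ exponents ∧ A.Nonempty ∧ D = diagram A

/-- `D'` is a deformation of the diagram `D`: it is the diagram spanned by `D` and some set of
exponents. -/
def IsDeformation (D D' : Set (ℝ × ℝ)) : Prop :=
  ∃ P : Set (ℝ × ℝ), P ⊆ exponents ∧ D' = diagram (D ∪ P)

/-- The Newton number `2A - a - b + 1` of a convenient diagram `D` (one that meets both axes):
`A` is the area of the part of the quadrant below `D`, and `a`, `b` are the distances from the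
origin to the points where `D` meets the two axes. -/
def convenientNumber (D : Set (ℝ × ℝ)) : ℝ :=
  2 * volume.real (Set.Ici (0 : ℝ × ℝ) \ polyhedron D)
    - sInf {a : ℝ | (a, 0) ∈ polyhedron D} - sInf {b : ℝ | (0, b) ∈ polyhedron D} + 1

/-- `D` together with the point at distance `m` from the origin on each coordinate axis that `D`
does not meet. A convenient diagram is left unchanged. -/
def completion (D : Set (ℝ × ℝ)) (m : ℕ) : Set (ℝ × ℝ) :=
  D ∪ {z | z = ((m : ℝ), 0) ∧ ∀ w ∈ D, w.2 ≠ 0} ∪ {z | z = (0, (m : ℝ)) ∧ ∀ w ∈ D, w.1 ≠ 0}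

/-- The Newton number of a diagram (Kouchnirenko): `2A - a - b + 1` if the diagram is convenient,
and in general the supremum, possibly infinite, of the Newton numbers of its completions by points
on the axes. -/
def newtonNumber (D : Set (ℝ × ℝ)) : EReal :=
  ⨆ m : ℕ, (convenientNumber (completion D (m + 1)) : EReal)

/-- The number `n` is attainable for `D`: it is the Newton number of some deformation of `D`. -/
def IsAttainable (D : Set (ℝ × ℝ)) (n : ℕ) : Prop :=
  ∃ D' : Set (ℝ × ℝ), IsDeformation D D' ∧ newtonNumber D' = ((n : ℝ) : EReal)

/-- The segment with end-points `(0, q)` and `(p, 0)`. -/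
def tr (p q : ℕ) : Set (ℝ × ℝ) :=
  segment ℝ ((0 : ℝ), (q : ℝ)) ((p : ℝ), (0 : ℝ))

end NewtonDiagram

end

/-!
The Newton number of the segment `tr p (k * p)` is `ν = (p - 1) * (k * p - 1)`. If the Newton
polyhedron of a finite set `P` of exponents contains the whole segment, then a diagram `D` inside
the segment does not influence the diagram of `D ∪ P` (`Reach.isAttainable`). It is therefore enough
to find, for each admissible `n`, a convex lattice chain from the second axis to the first, ending
at `(0, b)` and `(a, 0)` with `b ≤ k * p` and `a ≤ p`, whose Newton number is `n`; this is the
predicate `Reach`.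

Cutting the region below a chain into trapezoids gives its Newton number
(`convenientNumber_of_chain`). Measure points by their depth below the segment, so that `(x, y)` has
depth `k * (p - x) - y`. A convex chain from depth `h₀` in column `0` over depths `h₁`, `h₂` in
columns `x₁`, `x₂` to `(p, 0)` has Newton number
`ν - (h₀ * (x₁ - 1) + h₁ * x₂ + h₂ * (p - x₁))` (`reach_depth`), an expression in which `k` does not
occur. With `h₀ = 1` and a flat top of depth `h` and width `c` the decrease is
`h * p + (h * c + x₁ - 1)` (`reach_flat`). For `c = 0` this gives all remainders modulo `p` except
the largest one or two, whose columns would be too close to the right end; these come from `c = 1`,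
whose vertices lie further to the left. Only a few values need `c = 2`, a different starting depth,
or a triangle.

These chains reach every admissible `ν - δ` with `δ` below about `2 * k * p` and below `p ^ 2`
(`reach_of_quotient_lt`). This is enough for an induction on `p + k`: passing from `(p, k)` to
`(p - 1, k)` lowers `ν` by `2 * k * (p - 1) - 1`, and passing to `(p, k - 1)` lowers it by
`p * (p - 1)`. The first step is taken if `2 * k < p` and the second one otherwise; in both cases
the exceptional values of the smaller segment are again reached by an explicit chain
(`reach_of_step_left_odd`, `reach_of_step_down_even`).
-/

namespace NewtonDiagram

/-! ### Newton polyhedra and their diagrams -/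

lemma subset_polyhedron (S : Set (ℝ × ℝ)) : S ⊆ polyhedron S := fun z hz =>
  ⟨z, subset_convexHull ℝ S hz, 0, Set.mem_Ici.2 le_rfl, add_zero z⟩

lemma polyhedron_mono {S T : Set (ℝ × ℝ)} (h : S ⊆ T) : polyhedron S ⊆ polyhedron T :=
  Set.add_subset_add_right (convexHull_mono h)

lemma convex_polyhedron (S : Set (ℝ × ℝ)) : Convex ℝ (polyhedron S) :=
  (convex_convexHull ℝ S).add (convex_Ici 0)

lemma mem_polyhedron_of_le {S : Set (ℝ × ℝ)} {z w : ℝ × ℝ} (hz : z ∈ polyhedron S)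
    (h : z ≤ w) : w ∈ polyhedron S := by
  obtain ⟨u, hu, v, hv, rfl⟩ := hz
  exact ⟨u, hu, w - u, Set.mem_Ici.2 ((Set.mem_Ici.1 hv).trans (le_sub_iff_add_le'.2 h)), by simp⟩

/-- A Newton polyhedron is the smallest convex upper set containing its generators. -/
lemma polyhedron_subset {S T : Set (ℝ × ℝ)} (h : S ⊆ T) (hT : Convex ℝ T)
    (hup : ∀ z ∈ T, ∀ w, z ≤ w → w ∈ T) : polyhedron S ⊆ T := by
  rintro _ ⟨u, hu, v, hv, rfl⟩
  exact hup u (convexHull_min h hT hu) _ (le_add_of_nonneg_right (Set.mem_Ici.1 hv))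

lemma polyhedron_subset_polyhedron {S T : Set (ℝ × ℝ)} (h : S ⊆ polyhedron T) :
    polyhedron S ⊆ polyhedron T :=
  polyhedron_subset h (convex_polyhedron T) fun _ hz _ hw => mem_polyhedron_of_le hz hw

lemma polyhedron_union_eq {S T : Set (ℝ × ℝ)} (h : S ⊆ polyhedron T) :
    polyhedron (S ∪ T) = polyhedron T :=
  (polyhedron_subset_polyhedron (Set.union_subset h (subset_polyhedron T))).antisymm
    (polyhedron_mono Set.subset_union_right)

lemma nonneg_of_mem_exponents {z : ℝ × ℝ} (hz : z ∈ exponents) : 0 ≤ z := by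
  obtain ⟨a, b, rfl, -⟩ := hz
  exact ⟨Nat.cast_nonneg a, Nat.cast_nonneg b⟩

lemma nonneg_of_mem_polyhedron {S : Set (ℝ × ℝ)} (hS : ∀ z ∈ S, 0 ≤ z) {z : ℝ × ℝ}
    (hz : z ∈ polyhedron S) : 0 ≤ z :=
  polyhedron_subset (T := Set.Ici 0) hS (convex_Ici 0) (fun _ hz _ hw => le_trans hz hw) hz

lemma isClosed_polyhedron {S : Set (ℝ × ℝ)} (hS : S.Finite) : IsClosed (polyhedron S) := by
  have := isClosed_Ici (a := (0 : ℝ × ℝ)).add_left_of_isCompact (hS.isCompact_convexHull ℝ)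
  exact this

/-- Below every point of the Newton polyhedron of a finite set there is a point of the diagram:
minimize the sum of the coordinates on a compact part of the polyhedron. -/
lemma exists_mem_diagram_le {S : Set (ℝ × ℝ)} (hf : S.Finite) (hS : ∀ z ∈ S, 0 ≤ z)
    {z : ℝ × ℝ} (hz : z ∈ polyhedron S) : ∃ w ∈ diagram S, w ≤ z := by
  have hc : IsCompact (Set.Icc 0 z ∩ polyhedron S) :=
    isCompact_Icc.inter_right (isClosed_polyhedron hf)
  obtain ⟨w, hw, hmin⟩ := hc.exists_isMinOn ⟨z, ⟨nonneg_of_mem_polyhedron hS hz, le_rfl⟩, hz⟩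
    (f := fun u : ℝ × ℝ => u.1 + u.2) (by fun_prop)
  refine ⟨w, ⟨hw.2, fun u hu huw => ?_⟩, hw.1.2⟩
  have h := hmin (show u ∈ Set.Icc 0 z ∩ polyhedron S from
    ⟨⟨nonneg_of_mem_polyhedron hS hu, huw.trans hw.1.2⟩, hu⟩)
  simp only [Set.mem_ofPred_eq] at h
  have h1 := huw.1
  have h2 := huw.2
  exact ⟨by linarith, by linarith⟩

lemma polyhedron_diagram {S : Set (ℝ × ℝ)} (hf : S.Finite) (hS : ∀ z ∈ S, 0 ≤ z) :
    polyhedron (diagram S) = polyhedron S := by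
  refine (polyhedron_subset_polyhedron fun z hz => hz.1).antisymm fun z hz => ?_
  obtain ⟨w, hw, hwz⟩ := exists_mem_diagram_le hf hS hz
  exact mem_polyhedron_of_le (subset_polyhedron _ hw) hwz

/-- No completion is needed for a set that meets both axes. -/
lemma newtonNumber_eq_convenientNumber {S : Set (ℝ × ℝ)} (h1 : ∃ w ∈ S, w.2 = 0)
    (h2 : ∃ w ∈ S, w.1 = 0) : newtonNumber S = (convenientNumber S : EReal) := by
  have h (m : ℕ) : completion S m = S := by
    obtain ⟨u, hu, hu0⟩ := h1
    obtain ⟨v, hv, hv0⟩ := h2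
    ext z
    constructor
    · rintro ((hz | hz) | hz)
      · exact hz
      · exact absurd hu0 (hz.2 u hu)
      · exact absurd hv0 (hz.2 v hv)
    · exact fun hz => Or.inl (Or.inl hz)
  simp [newtonNumber, h]

/-! ### Area of a lattice polygon below a convex chain -/

/-- The point `z` lies on or above the line through `u` and `v`, where `u` is to the left of `v`.
Every point satisfies this if `u = v`. -/
def Above (u v z : ℝ × ℝ) : Prop :=
  0 ≤ (v.1 - u.1) * (z.2 - u.2) - (v.2 - u.2) * (z.1 - u.1)

lemma polyhedron_above {S : Set (ℝ × ℝ)} {u v : ℝ × ℝ} (h1 : u.1 ≤ v.1) (h2 : v.2 ≤ u.2)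
    (hS : ∀ z ∈ S, Above u v z) {z : ℝ × ℝ} (hz : z ∈ polyhedron S) : Above u v z := by
  refine polyhedron_subset (T := {z | Above u v z}) hS ?_ ?_ hz
  · intro z hz w hw s t hs ht hst
    simp only [Set.mem_ofPred_eq, Above, Prod.fst_add, Prod.snd_add, Prod.smul_fst, Prod.smul_snd,
      smul_eq_mul] at *
    obtain rfl : t = 1 - s := by linarith
    have := add_nonneg (mul_nonneg hs hz) (mul_nonneg ht hw)
    linarith
  · intro z hz w hw
    simp only [Set.mem_ofPred_eq, Above] at *
    have h3 := mul_le_mul_of_nonneg_left hw.2 (sub_nonneg.2 h1)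
    have h4 := mul_le_mul_of_nonneg_left hw.1 (sub_nonneg.2 h2)
    nlinarith

/-- The trapezoid between the first axis and the segment from `u` to `v`, without its upper and
right sides. -/
def trapezoid (u v : ℝ × ℝ) : Set (ℝ × ℝ) :=
  {z | u.1 ≤ z.1 ∧ z.1 < v.1 ∧ 0 ≤ z.2 ∧ ¬ Above u v z}

lemma measurableSet_trapezoid (u v : ℝ × ℝ) : MeasurableSet (trapezoid u v) := by
  have h1 : MeasurableSet {z : ℝ × ℝ | u.1 ≤ z.1} := measurableSet_le (by fun_prop) (by fun_prop)
  have h2 : MeasurableSet {z : ℝ × ℝ | z.1 < v.1} := measurableSet_lt (by fun_prop) (by fun_prop)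
  have h3 : MeasurableSet {z : ℝ × ℝ | 0 ≤ z.2} := measurableSet_le (by fun_prop) (by fun_prop)
  have h4 : MeasurableSet {z : ℝ × ℝ | Above u v z} :=
    measurableSet_le (by fun_prop) (by fun_prop)
  exact h1.inter (h2.inter (h3.inter h4.compl))

lemma volume_trapezoid {u v : ℝ × ℝ} (h : u.1 ≤ v.1) (hu : 0 ≤ u.2) (hv : 0 ≤ v.2) :
    volume (trapezoid u v) = ENNReal.ofReal ((u.2 + v.2) * (v.1 - u.1) / 2) := by
  rcases h.eq_or_lt with h | h
  · have : trapezoid u v = ∅ := by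
      ext z
      simp only [trapezoid, Set.mem_ofPred_eq, Set.mem_empty_iff_false, iff_false]
      rintro ⟨h1, h2, -⟩
      linarith
    simp [this, h]
  set m : ℝ := (v.2 - u.2) / (v.1 - u.1) with hm
  have hpos : 0 < v.1 - u.1 := sub_pos.2 h
  have hmv : m * (v.1 - u.1) = v.2 - u.2 := by rw [hm]; field_simp
  rw [Measure.volume_eq_prod, Measure.prod_apply (measurableSet_trapezoid u v)]
  have hslice (x : ℝ) : volume (Prod.mk x ⁻¹' trapezoid u v) =
      (Set.Ico u.1 v.1).indicator (fun x => ENNReal.ofReal (u.2 + m * (x - u.1))) x := by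
    by_cases hx : x ∈ Set.Ico u.1 v.1
    · rw [Set.indicator_of_mem hx]
      have : Prod.mk x ⁻¹' trapezoid u v = Set.Ico 0 (u.2 + m * (x - u.1)) := by
        ext y
        simp only [trapezoid, Above, Set.mem_preimage, Set.mem_ofPred_eq, not_le, Set.mem_Ico,
          hx.1, hx.2, true_and, and_congr_right_iff, ← hmv]
        intro _
        rw [show (v.1 - u.1) * (y - u.2) - m * (v.1 - u.1) * (x - u.1)
          = (v.1 - u.1) * (y - (u.2 + m * (x - u.1))) by ring]
        rw [mul_neg_iff]
        constructor
        · rintro (h' | h') <;> linarith [h'.1, h'.2]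
        · exact fun h' => Or.inl ⟨hpos, by linarith⟩
      rw [this, Real.volume_Ico, sub_zero]
    · rw [Set.indicator_of_notMem hx]
      have : Prod.mk x ⁻¹' trapezoid u v = ∅ := by
        ext y
        simp only [trapezoid, Set.mem_preimage, Set.mem_ofPred_eq, Set.mem_empty_iff_false,
          iff_false]
        exact fun h' => hx ⟨h'.1, h'.2.1⟩
      rw [this, measure_empty]
  simp_rw [hslice]
  rw [lintegral_indicator measurableSet_Ico, ← ofReal_integral_eq_lintegral_ofReal]
  · rw [integral_Ico_eq_integral_Ioc, ← intervalIntegral.integral_of_le h.le]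
    congr 1
    simp only [mul_sub]
    rw [intervalIntegral.integral_add (by simp) (by apply Continuous.intervalIntegrable; fun_prop),
      intervalIntegral.integral_sub (by apply Continuous.intervalIntegrable; fun_prop) (by simp),
      intervalIntegral.integral_const_mul, integral_id]
    simp only [intervalIntegral.integral_const, smul_eq_mul]
    rw [show v.2 = u.2 + m * (v.1 - u.1) by linarith]
    ring
  · exact (Continuous.integrableOn_Icc (by fun_prop)).mono_set Set.Ico_subset_Icc_self
  · refine (ae_restrict_iff' measurableSet_Ico).2 (Filter.Eventually.of_forall fun x hx => ?_)
    have h1 : 0 ≤ (v.1 - u.1) * (u.2 + m * (x - u.1)) := by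
      have : (v.1 - u.1) * (u.2 + m * (x - u.1))
          = (v.1 - x) * u.2 + (x - u.1) * v.2 := by
        rw [show v.2 = u.2 + m * (v.1 - u.1) by linarith]; ring
      rw [this]
      exact add_nonneg (mul_nonneg (sub_nonneg.2 hx.2.le) hu) (mul_nonneg (sub_nonneg.2 hx.1) hv)
    exact nonneg_of_mul_nonneg_right h1 hpos

lemma mem_polyhedron_of_above {S : Set (ℝ × ℝ)} {u v z : ℝ × ℝ} (hu : u ∈ polyhedron S)
    (hv : v ∈ polyhedron S) (h1 : u.1 ≤ z.1) (h2 : z.1 < v.1) (h : Above u v z) :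
    z ∈ polyhedron S := by
  have hpos : 0 < v.1 - u.1 := by linarith
  have hs : 0 ≤ (v.1 - z.1) / (v.1 - u.1) := div_nonneg (by linarith) hpos.le
  have ht : 0 ≤ (z.1 - u.1) / (v.1 - u.1) := div_nonneg (by linarith) hpos.le
  have := convex_polyhedron S hu hv hs ht (by field_simp; ring)
  refine mem_polyhedron_of_le this ⟨?_, ?_⟩
  · simp only [Prod.fst_add, Prod.smul_fst, smul_eq_mul]
    apply le_of_eq
    field_simp
    ring
  · simp only [Prod.snd_add, Prod.smul_snd, smul_eq_mul]
    rw [div_mul_eq_mul_div, div_mul_eq_mul_div, ← add_div, div_le_iff₀ hpos]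
    unfold Above at h
    linarith

/-! ### The Newton number of a convex chain with at most three edges -/

/-- Each edge condition says that all generators lie on or above the line through that edge. An
edge may have length zero, so chains with fewer edges and single segments are covered too; the
vertices need not be generators. -/
lemma convenientNumber_of_chain {S : Set (ℝ × ℝ)} {a b x₁ y₁ x₂ y₂ : ℝ}
    (h₀ : (0, b) ∈ polyhedron S) (h₁ : (x₁, y₁) ∈ polyhedron S)
    (h₂ : (x₂, y₂) ∈ polyhedron S) (h₃ : (a, 0) ∈ polyhedron S)
    (hx₁ : 0 < x₁) (hx₂ : x₁ ≤ x₂) (hxa : x₂ ≤ a) (hy₂ : 0 < y₂) (hy₁ : y₂ ≤ y₁) (hyb : y₁ ≤ b)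
    (e₁ : ∀ z ∈ S, Above (0, b) (x₁, y₁) z) (e₂ : ∀ z ∈ S, Above (x₁, y₁) (x₂, y₂) z)
    (e₃ : ∀ z ∈ S, Above (x₂, y₂) (a, 0) z) :
    convenientNumber S = b * x₁ + (x₂ * y₁ - x₁ * y₂) + a * y₂ - a - b + 1 := by
  have k₁ : ∀ z ∈ polyhedron S, Above (0, b) (x₁, y₁) z :=
    fun z hz => polyhedron_above hx₁.le hyb e₁ hz
  have k₂ : ∀ z ∈ polyhedron S, Above (x₁, y₁) (x₂, y₂) z :=
    fun z hz => polyhedron_above hx₂ hy₁ e₂ hz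
  have k₃ : ∀ z ∈ polyhedron S, Above (x₂, y₂) (a, 0) z :=
    fun z hz => polyhedron_above hxa hy₂.le e₃ hz
  have hreg : Set.Ici (0 : ℝ × ℝ) \ polyhedron S =
      trapezoid (0, b) (x₁, y₁) ∪ (trapezoid (x₁, y₁) (x₂, y₂) ∪ trapezoid (x₂, y₂) (a, 0)) := by
    ext z
    constructor
    · rintro ⟨hz, hn⟩
      have hz1 : 0 ≤ z.1 := hz.1
      have hz2 : 0 ≤ z.2 := hz.2
      rcases lt_or_ge z.1 x₁ with l₁ | l₁
      · exact Or.inl ⟨hz1, l₁, hz2, fun h => hn (mem_polyhedron_of_above h₀ h₁ hz1 l₁ h)⟩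
      rcases lt_or_ge z.1 x₂ with l₂ | l₂
      · exact Or.inr (Or.inl ⟨l₁, l₂, hz2, fun h => hn (mem_polyhedron_of_above h₁ h₂ l₁ l₂ h)⟩)
      rcases lt_or_ge z.1 a with l₃ | l₃
      · exact Or.inr (Or.inr ⟨l₂, l₃, hz2, fun h => hn (mem_polyhedron_of_above h₂ h₃ l₂ l₃ h)⟩)
      · exact absurd (mem_polyhedron_of_le h₃ ⟨l₃, hz2⟩) hn
    · rintro (⟨l, -, hz, hn⟩ | ⟨l, -, hz, hn⟩ | ⟨l, -, hz, hn⟩)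
      · exact ⟨⟨l, hz⟩, fun h => hn (k₁ z h)⟩
      · exact ⟨⟨hx₁.le.trans l, hz⟩, fun h => hn (k₂ z h)⟩
      · exact ⟨⟨(hx₁.le.trans hx₂).trans l, hz⟩, fun h => hn (k₃ z h)⟩
  have harea : volume.real (Set.Ici (0 : ℝ × ℝ) \ polyhedron S) =
      (b + y₁) * x₁ / 2 + ((y₁ + y₂) * (x₂ - x₁) / 2 + y₂ * (a - x₂) / 2) := by
    have n₁ : 0 ≤ (b + y₁) * x₁ / 2 := by
      have := mul_nonneg (show 0 ≤ b + y₁ by linarith) hx₁.le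
      linarith
    have n₂ : 0 ≤ (y₁ + y₂) * (x₂ - x₁) / 2 := by
      have := mul_nonneg (show 0 ≤ y₁ + y₂ by linarith) (sub_nonneg.2 hx₂)
      linarith
    have n₃ : 0 ≤ y₂ * (a - x₂) / 2 := by
      have := mul_nonneg hy₂.le (sub_nonneg.2 hxa)
      linarith
    have d₂ : Disjoint (trapezoid (x₁, y₁) (x₂, y₂)) (trapezoid (x₂, y₂) (a, 0)) :=
      Set.disjoint_left.2 fun z hz hz' => absurd hz.2.1 (not_lt.2 hz'.1)
    have d₁ : Disjoint (trapezoid (0, b) (x₁, y₁))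
        (trapezoid (x₁, y₁) (x₂, y₂) ∪ trapezoid (x₂, y₂) (a, 0)) :=
      Set.disjoint_left.2 fun z hz hz' => absurd hz.2.1
        (not_lt.2 (hz'.elim (fun h => h.1) fun h => hx₂.trans h.1))
    rw [hreg, Measure.real, measure_union d₁
      ((measurableSet_trapezoid _ _).union (measurableSet_trapezoid _ _)),
      measure_union d₂ (measurableSet_trapezoid _ _),
      volume_trapezoid hx₁.le (by simpa using by linarith) (by simpa using by linarith),
      volume_trapezoid hx₂ (by simpa using by linarith) (by simpa using by linarith),
      volume_trapezoid hxa (by simpa using by linarith) le_rfl]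
    simp only [sub_zero, add_zero]
    rw [← ENNReal.ofReal_add n₂ n₃, ← ENNReal.ofReal_add n₁ (add_nonneg n₂ n₃),
      ENNReal.toReal_ofReal (add_nonneg n₁ (add_nonneg n₂ n₃))]
  have ha : IsLeast {t : ℝ | (t, 0) ∈ polyhedron S} a := by
    refine ⟨h₃, fun t ht => ?_⟩
    have := k₃ _ ht
    simp only [Above] at this
    nlinarith
  have hb : IsLeast {t : ℝ | (0, t) ∈ polyhedron S} b := by
    refine ⟨h₀, fun t ht => ?_⟩
    have := k₁ _ ht
    simp only [Above] at this
    nlinarith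
  rw [convenientNumber, harea, ha.csInf_eq, hb.csInf_eq]
  ring

lemma convenientNumber_pair {a b : ℕ} (ha : 1 ≤ a) (hb : 1 ≤ b) :
    convenientNumber {((0 : ℝ), (b : ℝ)), ((a : ℝ), (0 : ℝ))} = ((a : ℝ) - 1) * (b - 1) := by
  have ha' : (1 : ℝ) ≤ a := by exact_mod_cast ha
  have hb' : (1 : ℝ) ≤ b := by exact_mod_cast hb
  set S : Set (ℝ × ℝ) := {((0 : ℝ), (b : ℝ)), ((a : ℝ), (0 : ℝ))} with hS
  have h₀ : ((0 : ℝ), (b : ℝ)) ∈ polyhedron S := subset_polyhedron S (by simp [hS])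
  have h₁ : ((a : ℝ), (0 : ℝ)) ∈ polyhedron S := subset_polyhedron S (by simp [hS])
  have hm : ((a : ℝ) / 2, (b : ℝ) / 2) ∈ polyhedron S := by
    have := convex_polyhedron S h₀ h₁ (show (0 : ℝ) ≤ 1 / 2 by norm_num)
      (show (0 : ℝ) ≤ 1 / 2 by norm_num) (by norm_num)
    convert this using 1
    ext <;> simp <;> ring
  -- The middle of the segment serves as both inner vertices.
  rw [convenientNumber_of_chain (S := S) h₀ hm hm h₁ (by linarith) le_rfl (by linarith)
    (by linarith) le_rfl (by linarith)]
  · ring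
  · rintro z (rfl | rfl) <;> simp only [Above] <;> apply le_of_eq <;> ring
  · rintro z (rfl | rfl) <;> simp only [Above] <;> apply le_of_eq <;> ring
  · rintro z (rfl | rfl) <;> simp only [Above] <;> apply le_of_eq <;> ring

/-! ### Newton numbers reached below a segment -/

/-- The number `n` is the Newton number of the diagram of a finite set of exponents whose Newton
polyhedron contains `(a, 0)` and `(0, b)`, hence the whole segment between these two points. -/
def Reach (a b n : ℕ) : Prop :=
  ∃ P : Set (ℝ × ℝ), P ⊆ exponents ∧ P.Finite ∧ ((a : ℝ), (0 : ℝ)) ∈ polyhedron P ∧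
    ((0 : ℝ), (b : ℝ)) ∈ polyhedron P ∧ newtonNumber (diagram P) = ((n : ℝ) : EReal)

lemma Reach.mono {a b a' b' n : ℕ} (h : Reach a b n) (ha : a ≤ a') (hb : b ≤ b') :
    Reach a' b' n := by
  obtain ⟨P, hP, hf, h1, h2, hn⟩ := h
  exact ⟨P, hP, hf, mem_polyhedron_of_le h1 ⟨Nat.cast_le.2 ha, le_rfl⟩,
    mem_polyhedron_of_le h2 ⟨le_rfl, Nat.cast_le.2 hb⟩, hn⟩

/-- Such a number is attainable for every subset of the segment: the subset lies in the polyhedron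
of `P` and does not influence the deformation by `P`. -/
lemma Reach.isAttainable {p q n : ℕ} (h : Reach p q n) {D : Set (ℝ × ℝ)} (hD : D ⊆ tr p q) :
    IsAttainable D n := by
  obtain ⟨P, hP, hf, h1, h2, hn⟩ := h
  refine ⟨diagram (D ∪ P), ⟨P, hP, rfl⟩, ?_⟩
  have hDP : D ⊆ polyhedron P := hD.trans ((convex_polyhedron P).segment_subset h2 h1)
  rw [← hn, diagram, diagram, polyhedron_union_eq hDP]

lemma newtonNumber_diagram {P : Set (ℝ × ℝ)} (hP : P ⊆ exponents) (hf : P.Finite) {a b : ℝ}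
    (h1 : (a, 0) ∈ polyhedron P) (h2 : (0, b) ∈ polyhedron P) :
    newtonNumber (diagram P) = (convenientNumber P : EReal) := by
  have hnn : ∀ z ∈ P, 0 ≤ z := fun z hz => nonneg_of_mem_exponents (hP hz)
  rw [newtonNumber_eq_convenientNumber]
  · simp only [convenientNumber, polyhedron_diagram hf hnn]
  · obtain ⟨w, hw, hle⟩ := exists_mem_diagram_le hf hnn h1
    exact ⟨w, hw, le_antisymm hle.2 (nonneg_of_mem_polyhedron hnn hw.1).2⟩
  · obtain ⟨w, hw, hle⟩ := exists_mem_diagram_le hf hnn h2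
    exact ⟨w, hw, le_antisymm hle.1 (nonneg_of_mem_polyhedron hnn hw.1).1⟩

lemma mem_exponents {a b : ℕ} (h : 0 < a + b) : ((a : ℝ), (b : ℝ)) ∈ exponents := by
  refine ⟨a, b, rfl, fun h0 => ?_⟩
  have h1 : (a : ℝ) = 0 := congrArg Prod.fst h0
  have h2 : (b : ℝ) = 0 := congrArg Prod.snd h0
  norm_cast at h1 h2
  omega

lemma reach_pair {a b n : ℕ} (ha : 1 ≤ a) (hb : 1 ≤ b)
    (hn : (n : ℤ) = ((a : ℤ) - 1) * (b - 1)) : Reach a b n := by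
  have hn' : (n : ℝ) = ((a : ℝ) - 1) * (b - 1) := by exact_mod_cast hn
  have h₀ : ((0 : ℝ), (b : ℝ)) ∈ ({((0 : ℝ), (b : ℝ)), ((a : ℝ), (0 : ℝ))} : Set (ℝ × ℝ)) := by
    simp
  have h₁ : ((a : ℝ), (0 : ℝ)) ∈ ({((0 : ℝ), (b : ℝ)), ((a : ℝ), (0 : ℝ))} : Set (ℝ × ℝ)) := by
    simp
  have hP : ({((0 : ℝ), (b : ℝ)), ((a : ℝ), (0 : ℝ))} : Set (ℝ × ℝ)) ⊆ exponents := by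
    rintro z (rfl | rfl)
    · simpa using mem_exponents (a := 0) (b := b) (by omega)
    · simpa using mem_exponents (a := a) (b := 0) (by omega)
  refine ⟨_, hP, Set.toFinite _, subset_polyhedron _ h₁, subset_polyhedron _ h₀, ?_⟩
  rw [newtonNumber_diagram hP (Set.toFinite _) (subset_polyhedron _ h₁) (subset_polyhedron _ h₀),
    convenientNumber_pair ha hb, hn']

/-- The Newton number of the lattice chain `(0, b)`, `(x₁, y₁)`, `(x₂, y₂)`, `(a, 0)`. The hypotheses
`e₁₂`, `e₁₃`, `e₂₃`, `e₃₀` say that no three of the vertices, taken from left to right, make a right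
turn. -/
lemma reach_chain {a b x₁ y₁ x₂ y₂ n : ℕ}
    (hx₁ : 0 < x₁) (hx₂ : x₁ ≤ x₂) (hxa : x₂ ≤ a) (hy₂ : 0 < y₂) (hy₁ : y₂ ≤ y₁) (hyb : y₁ ≤ b)
    (e₁₂ : (0 : ℤ) ≤ (x₁ - 0) * (y₂ - b) - (y₁ - b) * (x₂ - 0))
    (e₁₃ : (0 : ℤ) ≤ (x₁ - 0) * (0 - b) - (y₁ - b) * (a - 0))
    (e₂₃ : (0 : ℤ) ≤ (x₂ - x₁) * (0 - y₁) - (y₂ - y₁) * (a - x₁))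
    (e₃₀ : (0 : ℤ) ≤ (a - x₂) * (b - y₂) - (0 - y₂) * (0 - x₂))
    (hn : (n : ℤ) = b * x₁ + (x₂ * y₁ - x₁ * y₂) + a * y₂ - a - b + 1) : Reach a b n := by
  have hn' : (n : ℝ) = b * x₁ + (x₂ * y₁ - x₁ * y₂) + a * y₂ - a - b + 1 := by exact_mod_cast hn
  set P : Set (ℝ × ℝ) := {((0 : ℝ), (b : ℝ)), ((x₁ : ℝ), (y₁ : ℝ)), ((x₂ : ℝ), (y₂ : ℝ)),
    ((a : ℝ), (0 : ℝ))} with hPdef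
  have e₂₀ : (0 : ℤ) ≤ (x₂ - x₁) * (b - y₁) - (y₂ - y₁) * (0 - x₁) := by linarith
  have e₃₁ : (0 : ℤ) ≤ (a - x₂) * (y₁ - y₂) - (0 - y₂) * (x₁ - x₂) := by linarith
  have h₀ : ((0 : ℝ), (b : ℝ)) ∈ polyhedron P := subset_polyhedron P (by simp [hPdef])
  have h₁ : ((x₁ : ℝ), (y₁ : ℝ)) ∈ polyhedron P := subset_polyhedron P (by simp [hPdef])
  have h₂ : ((x₂ : ℝ), (y₂ : ℝ)) ∈ polyhedron P := subset_polyhedron P (by simp [hPdef])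
  have h₃ : ((a : ℝ), (0 : ℝ)) ∈ polyhedron P := subset_polyhedron P (by simp [hPdef])
  have hf : P.Finite := Set.toFinite _
  have hP : P ⊆ exponents := by
    rintro z (rfl | rfl | rfl | rfl)
    · simpa using mem_exponents (a := 0) (b := b) (by omega)
    · exact mem_exponents (by omega)
    · exact mem_exponents (by omega)
    · simpa using mem_exponents (a := a) (b := 0) (by omega)
  refine ⟨P, hP, hf, h₃, h₀, ?_⟩
  rw [newtonNumber_diagram hP hf h₃ h₀, convenientNumber_of_chain
    h₀ h₁ h₂ h₃ (by exact_mod_cast hx₁)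
    (by exact_mod_cast hx₂) (by exact_mod_cast hxa) (by exact_mod_cast hy₂)
    (by exact_mod_cast hy₁) (by exact_mod_cast hyb), hn']
  · rintro z (rfl | rfl | rfl | rfl)
    · simp [Above]
    · simp only [Above]; apply le_of_eq; ring
    · simp only [Above]; exact_mod_cast e₁₂
    · simp only [Above]; exact_mod_cast e₁₃
  · rintro z (rfl | rfl | rfl | rfl)
    · simp only [Above]; exact_mod_cast e₂₀
    · simp [Above]
    · simp only [Above]; apply le_of_eq; ring
    · simp only [Above]; exact_mod_cast e₂₃
  · rintro z (rfl | rfl | rfl | rfl)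
    · simp only [Above]; exact_mod_cast e₃₀
    · simp only [Above]; exact_mod_cast e₃₁
    · simp [Above]
    · simp only [Above]; apply le_of_eq; ring

lemma newtonNumber_tr {p q : ℕ} (hp : 1 ≤ p) (hq : 1 ≤ q) :
    newtonNumber (tr p q) = ((((p : ℝ) - 1) * (q - 1) : ℝ) : EReal) := by
  have h1 : ∃ w ∈ tr p q, w.2 = 0 := ⟨_, right_mem_segment ℝ _ _, rfl⟩
  have h2 : ∃ w ∈ tr p q, w.1 = 0 := ⟨_, left_mem_segment ℝ _ _, rfl⟩
  rw [newtonNumber_eq_convenientNumber h1 h2, ← convenientNumber_pair hp hq]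
  have : polyhedron (tr p q) = polyhedron {((0 : ℝ), (q : ℝ)), ((p : ℝ), (0 : ℝ))} := by
    simp only [polyhedron, tr, ← convexHull_pair, (convex_convexHull ℝ _).convexHull_eq]
  simp only [convenientNumber, this]

/-! ### Chains below the segment from `(0, k * p)` to `(p, 0)` -/

/-- The point at depth `h` in column `x` is `(x, k * (p - x) - h)`. In these coordinates a convex
chain below the segment becomes the graph of a concave function, which takes the values `h₀`, `h₁`,
`h₂`, `0` at `0`, `x₁`, `x₂`, `p`, and the Newton number is that of the segment minus an expression
independent of `k`. -/
lemma reach_depth {p k h₀ x₁ h₁ x₂ h₂ n : ℕ} (hx₁ : 0 < x₁) (hx₂ : x₁ ≤ x₂) (hxp : x₂ ≤ p)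
    (hy₂ : h₂ + k * x₂ < k * p) (hy₁ : h₁ + k * x₁ ≤ h₂ + k * x₂) (hyb : h₀ ≤ h₁ + k * x₁)
    (c₁₂ : (0 : ℤ) ≤ (h₁ - h₀) * x₂ - x₁ * (h₂ - h₀))
    (c₁₃ : (0 : ℤ) ≤ (h₁ - h₀) * p + x₁ * h₀)
    (c₂₃ : (0 : ℤ) ≤ (h₂ - h₁) * (p - x₁) + (x₂ - x₁) * h₁)
    (c₃₀ : (0 : ℤ) ≤ h₂ * x₂ - (p - x₂) * (h₀ - h₂))
    (hn : (n : ℤ) + (h₀ * (x₁ - 1) + h₁ * x₂ + h₂ * (p - x₁)) = (p - 1) * (k * p - 1)) :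
    Reach p (k * p) n := by
  obtain ⟨y₂, e₂⟩ : ∃ y₂, k * p = y₂ + (h₂ + k * x₂) := Nat.exists_eq_add_of_le' hy₂.le
  obtain ⟨y₁, e₁⟩ : ∃ y₁, k * p = y₁ + (h₁ + k * x₁) :=
    Nat.exists_eq_add_of_le' (hy₁.trans hy₂.le)
  obtain ⟨b, e₀⟩ : ∃ b, k * p = b + h₀ := Nat.exists_eq_add_of_le' (by omega)
  have z₂ : (y₂ : ℤ) = k * p - h₂ - k * x₂ := by
    have : (k : ℤ) * p = y₂ + (h₂ + k * x₂) := by exact_mod_cast e₂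
    linarith
  have z₁ : (y₁ : ℤ) = k * p - h₁ - k * x₁ := by
    have : (k : ℤ) * p = y₁ + (h₁ + k * x₁) := by exact_mod_cast e₁
    linarith
  have z₀ : (b : ℤ) = k * p - h₀ := by
    have : (k : ℤ) * p = b + h₀ := by exact_mod_cast e₀
    linarith
  refine Reach.mono (a := p) (b := b) ?_ le_rfl (by omega)
  refine reach_chain (x₁ := x₁) (y₁ := y₁) (x₂ := x₂) (y₂ := y₂) hx₁ hx₂ hxp (by omega) (by omega)
    (by omega) ?_ ?_ ?_ ?_ ?_
  · rw [z₂, z₁, z₀]; linarith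
  · rw [z₁, z₀]; linarith
  · rw [z₂, z₁]; linarith
  · rw [z₂, z₀]; linarith
  · rw [z₂, z₁, z₀]; linarith

/-- A chain with one vertex between its end-points. The hypothesis `h < k * j` keeps the vertex above
the first axis, as its column is at distance at least `j` from the right end. -/
lemma reach_vertex {p k h₀ x h n δ : ℕ} (j : ℕ) (hx : 0 < x) (hj : x + j ≤ p) (hh : h < k * j)
    (hyb : h₀ ≤ h + k * x) (hc : h₀ * p ≤ h * p + h₀ * x)
    (hδ : n + δ = (p - 1) * (k * p - 1)) (hd : δ = h₀ * (x - 1) + h * p) :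
    Reach p (k * p) n := by
  have hy : h + k * x < k * p := by
    have := Nat.mul_le_mul_left k hj
    rw [Nat.mul_add] at this
    omega
  have hkp : 1 ≤ k * p := by omega
  have hc' : (h₀ : ℤ) * p ≤ h * p + h₀ * x := by exact_mod_cast hc
  have h4 : (0 : ℤ) ≤ h * (p - x) := mul_nonneg (by positivity) (by omega)
  subst hd
  zify [hkp, show 1 ≤ x from hx, show 1 ≤ p by omega] at hδ
  refine reach_depth hx le_rfl (by omega) hy le_rfl hyb ?_ ?_ ?_ ?_ ?_ <;> linarith

/-- The chain of depths `1, h, h, 0` with its two upper vertices in the columns `x` and `x + c`.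
Writing the decrease of the Newton number as `h * p + (h * c + x - 1)`, one sees how the choice of
`x` and `c` realizes the remainders modulo `p`. -/
lemma reach_flat {p k n δ : ℕ} (h x c j : ℕ) (hh : 1 ≤ h) (hx : 0 < x) (hj : x + c + j ≤ p)
    (hk : h < k * j) (hδ : n + δ = (p - 1) * (k * p - 1)) (hd : δ + 1 = h * p + h * c + x) :
    Reach p (k * p) n := by
  have hy : h + k * (x + c) < k * p := by
    have := Nat.mul_le_mul_left k hj
    rw [Nat.mul_add] at this
    omega
  have hkp : 1 ≤ k * p := by omega
  zify [hkp, show 1 ≤ p by omega] at hδ hd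
  have a1 : (0 : ℤ) ≤ (h - 1) * c := mul_nonneg (by omega) (by omega)
  have a2 : (0 : ℤ) ≤ (h - 1) * p := mul_nonneg (by omega) (by omega)
  have a3 : (0 : ℤ) ≤ (h - 1) * (p - (x + c)) := mul_nonneg (by omega) (by omega)
  have a4 : (0 : ℤ) ≤ h * c := by positivity
  have a5 : (0 : ℤ) ≤ h * (x + c) := by positivity
  have a6 : k * x ≤ k * (x + c) := Nat.mul_le_mul_left k (by omega)
  refine reach_depth (h₀ := 1) (h₁ := h) hx (Nat.le_add_right x c) (by omega) hy (by omega)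
    (by omega) ?_ ?_ ?_ ?_ ?_ <;> push_cast <;> linarith

/-- The values `n` with `n < b` come from triangles with base `2`. -/
lemma reach_small {p b n : ℕ} (hp : 2 ≤ p) (hn : n < b) : Reach p b n :=
  (reach_pair (a := 2) (b := n + 1) (by norm_num) (by omega) (by push_cast; ring)).mono hp hn

/-! ### Filling the gaps -/

/-- Newton numbers `ν - δ` with `p ≤ δ < 2 * k * p` and `δ < p ^ 2`, where `δ = h * p + t`. -/
lemma reach_of_quotient_lt {p k h t n : ℕ} (hp : 3 ≤ p) (h1 : 1 ≤ h) (hhp : h < p)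
    (hhk : h < 2 * k) (ht : t < p) (hex : ¬ (Even p ∧ h = 1 ∧ t + 1 = p))
    (hn : n + (h * p + t) = (p - 1) * (k * p - 1)) : Reach p (k * p) n := by
  -- A chain `1, h, 0` reaches the remainders below `p - 1`, or below `p - 2` if `k ≤ h`.
  by_cases hA : t + 2 ≤ p ∧ (h < k ∨ t + 3 ≤ p)
  · rcases hA with ⟨hA, hB | hB⟩
    · exact reach_flat h (t + 1) 0 1 h1 (by omega) (by omega) (by omega) hn (by omega)
    · exact reach_flat h (t + 1) 0 2 h1 (by omega) (by omega) (by omega) hn (by omega)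
  by_cases ht1 : t + 1 = p
  · rcases (show h = 1 ∨ 2 ≤ h by omega) with rfl | h2
    · -- Here `δ = 2 * p - 1`, which needs `p` odd.
      have hodd : Odd p := Nat.not_even_iff_odd.1 fun he => hex ⟨he, rfl, ht1⟩
      obtain ⟨m, rfl⟩ := hodd
      rcases (show k = 1 ∨ 2 ≤ k by omega) with rfl | hk
      · rcases (show m = 1 ∨ 2 ≤ m by omega) with rfl | hm
        · norm_num at hn
          omega
        · exact reach_vertex (h₀ := 2) (x := m + 1) (h := 1) 2 (by omega) (by omega) (by omega)
            (by omega) (by omega) hn (by omega)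
      · have : k ≤ k * (m + 1) := Nat.le_mul_of_pos_right k (by omega)
        exact reach_vertex (h₀ := 2) (x := m + 1) (h := 1) 1 (by omega) (by omega) (by omega)
          (by omega) (by omega) hn (by omega)
    · rcases (show h < k ∨ k ≤ h ∧ 3 ≤ h ∨ h = 2 ∧ k = 2 by omega) with hk | ⟨hk, h3⟩ | ⟨rfl, rfl⟩
      · exact reach_flat h (p - h) 1 1 h1 (by omega) (by omega) (by omega) hn (by omega)
      · exact reach_flat h (p - h) 1 2 h1 (by omega) (by omega) (by omega) hn (by omega)
      · rcases (show p = 3 ∨ p = 4 ∨ 5 ≤ p by omega) with rfl | rfl | hp5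
        · exact reach_small (by omega) (by omega)
        · obtain rfl : n = 10 := by omega
          exact (reach_pair (a := 3) (b := 6) (by norm_num) (by norm_num) (by norm_num)).mono
            (by norm_num) (by norm_num)
        · refine reach_depth (h₀ := 2) (x₁ := 3) (h₁ := 2) (x₂ := p - 1) (h₂ := 1)
            (by omega) (by omega) (by omega) (by omega) (by omega) (by omega) ?_ ?_ ?_ ?_ ?_
          all_goals zify [show 1 ≤ p by omega, show 1 ≤ 2 * p by omega] at hn ht1 ⊢
          all_goals omega
  -- What remains is `t = p - 2` with `k ≤ h`.
  obtain ⟨ht2, hk⟩ : t + 2 = p ∧ k ≤ h := by omega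
  rcases (show h = 1 ∨ 2 ≤ h by omega) with rfl | h2
  · obtain rfl : k = 1 := by omega
    refine (reach_pair (a := p) (b := p - 2) (by omega) (by omega) ?_).mono le_rfl (by omega)
    zify [show 2 ≤ p by omega, show 1 ≤ p by omega, show 1 ≤ 1 * p by omega] at hn ht2 ⊢
    linarith
  rcases (show h + 2 ≤ p ∨ h + 1 = p by omega) with h3 | h3
  · exact reach_flat h (p - 1 - h) 1 2 h1 (by omega) (by omega) (by omega) hn (by omega)
  -- Now `δ = p ^ 2 - 2`.
  obtain rfl : p = h + 1 := h3.symm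
  rcases Nat.even_or_odd (h + 1) with he | ho
  · obtain ⟨m, hm⟩ := he
    refine reach_vertex (h₀ := 2) (x := m) (h := h) 2 (by omega) (by omega) (by omega)
      (by omega) ?_ hn (by omega)
    have := Nat.mul_le_mul_right (h + 1) h2
    omega
  · obtain ⟨m, hm⟩ := ho
    rcases (show m = 1 ∨ m = 2 ∨ 3 ≤ m by omega) with rfl | rfl | hm3
    · obtain rfl : h = 2 := by omega
      obtain rfl : k = 2 := by omega
      exact reach_small (by omega) (by omega)
    · obtain rfl : h = 4 := by omega
      exact reach_vertex (h₀ := 3) (x := 2) (h := 4) 3 (by omega) (by omega) (by omega)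
        (by omega) (by omega) hn (by omega)
    · obtain ⟨g, rfl⟩ : ∃ g, h = g + 1 := ⟨h - 1, by omega⟩
      refine reach_flat g 3 2 2 (by omega) (by omega) (by omega) (by omega) hn ?_
      have : t = g := by omega
      subst this
      ring

/-- The gap left by the inductive step from `(p - 1, k)` to `(p, k)`. -/
lemma reach_of_step_left {p k δ n : ℕ} (hp : 3 ≤ p) (hk : 1 ≤ k) (hkp : 2 * k + 1 ≤ p)
    (hpδ : p ≤ δ) (hex : ¬ (Even p ∧ δ + 1 = 2 * p))
    (hδ : δ + 3 ≤ (2 * k + 1) * (p - 1)) (hn : n + δ = (p - 1) * (k * p - 1)) :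
    Reach p (k * p) n := by
  have hdm : δ / p * p + δ % p = δ := Nat.div_add_mod' δ p
  have ht : δ % p < p := Nat.mod_lt _ (by omega)
  have hh1 : 1 ≤ δ / p := (Nat.one_le_div_iff (by omega)).2 hpδ
  generalize δ / p = h at *
  generalize δ % p = t at *
  obtain ⟨r, rfl⟩ : ∃ r, p = r + 1 := ⟨p - 1, by omega⟩
  have hr : (2 * k + 1) * (r + 1 - 1) = 2 * k * (r + 1) + r - 2 * k := by
    have : (2 * k + 1) * r + 2 * k = 2 * k * (r + 1) + r := by ring
    rw [Nat.add_sub_cancel]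
    omega
  have hlt : h < 2 * k + 1 := by
    refine lt_of_mul_lt_mul_right (a := r + 1) ?_ (Nat.zero_le _)
    have : (2 * k + 1) * (r + 1) = 2 * k * (r + 1) + (r + 1) := by ring
    omega
  rcases (show h < 2 * k ∨ h = 2 * k by omega) with hlt | rfl
  · refine reach_of_quotient_lt hp hh1 (by omega) hlt ht ?_ (by rw [hdm]; exact hn)
    rintro ⟨he, rfl, h2⟩
    exact hex ⟨he, by omega⟩
  · exact reach_flat (2 * k) (t + 1) 0 3 hh1 (by omega) (by omega) (by omega) hn (by omega)

/-- The value that the step from `(p - 1, k)` to `(p, k)` misses because it is exceptional for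
the even number `p - 1`. -/
lemma reach_of_step_left_odd {p k δ n : ℕ} (hp : 3 ≤ p) (hk : 1 ≤ k) (hkp : 2 * k + 1 ≤ p)
    (ho : Odd p) (hn1 : 1 ≤ n) (hδ : δ + 2 = (2 * k + 2) * (p - 1))
    (hn : n + δ = (p - 1) * (k * p - 1)) : Reach p (k * p) n := by
  obtain ⟨m, rfl⟩ := ho
  rw [Nat.add_sub_cancel] at hδ
  rcases (show k + 2 ≤ m ∨ m = k + 1 ∨ m = k by omega) with hm | rfl | rfl
  · refine reach_flat (2 * k + 1) (2 * m + 1 - 2 * k - 3) 0 4 (by omega) (by omega) (by omega)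
      (by omega) hn ?_
    have : (2 * k + 1) * (2 * m + 1) = (2 * k + 2) * (2 * m) + 2 * k + 1 - 2 * m := by
      have : (2 * k + 1) * (2 * m + 1) + 2 * m = (2 * k + 2) * (2 * m) + 2 * k + 1 := by ring
      omega
    have : 2 * m ≤ (2 * k + 2) * (2 * m) := Nat.le_mul_of_pos_left _ (by omega)
    omega
  · rcases (show k = 1 ∨ 2 ≤ k by omega) with rfl | hk2
    · exact reach_small (by omega) (by norm_num at *; omega)
    · refine reach_flat (2 * k) 3 1 3 (by omega) (by omega) (by omega) (by omega) hn ?_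
      have : (2 * k + 2) * (2 * (k + 1)) = 2 * k * (2 * (k + 1) + 1) + 2 * k * 1 + 4 := by ring
      omega
  · rcases (show m = 1 ∨ m = 2 ∨ 3 ≤ m by omega) with rfl | rfl | hm
    · norm_num at *
      omega
    · exact reach_vertex (h₀ := 2) (x := 2) (h := 4) 3 (by omega) (by omega) (by omega)
        (by omega) (by omega) hn (by omega)
    · obtain ⟨g, rfl⟩ : ∃ g, m = g + 1 := ⟨m - 1, by omega⟩
      refine reach_flat (2 * g + 1) 2 2 2 (by omega) (by omega) (by omega) (by omega) hn ?_
      have : (2 * (g + 1) + 2) * (2 * (g + 1))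
          = (2 * g + 1) * (2 * (g + 1) + 1) + (2 * g + 1) * 2 + 3 := by ring
      omega

/-- The gap left by the inductive step from `(p, k - 1)` to `(p, k)`. -/
lemma reach_of_step_down {p k δ n : ℕ} (hp : 3 ≤ p) (hkp : p ≤ 2 * k)
    (hpδ : p ≤ δ) (hex : ¬ (Even p ∧ δ + 1 = 2 * p)) (hδ : δ < p * p)
    (hn : n + δ = (p - 1) * (k * p - 1)) : Reach p (k * p) n := by
  have hdm : δ / p * p + δ % p = δ := Nat.div_add_mod' δ p
  have ht : δ % p < p := Nat.mod_lt _ (by omega)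
  have hh1 : 1 ≤ δ / p := (Nat.one_le_div_iff (by omega)).2 hpδ
  have hlt : δ / p < p := Nat.div_lt_of_lt_mul hδ
  refine reach_of_quotient_lt hp hh1 hlt (by omega) ht ?_ (by rw [hdm]; exact hn)
  rintro ⟨he, h1, h2⟩
  rw [h1] at hdm
  exact hex ⟨he, by omega⟩

/-- The value that the step from `(p, k - 1)` to `(p, k)` misses for even `p`. -/
lemma reach_of_step_down_even {p k δ n : ℕ} (hp : 3 ≤ p) (hkp : p ≤ 2 * k) (he : Even p)
    (hδ : δ + 1 = p * p + p) (hn : n + δ = (p - 1) * (k * p - 1)) : Reach p (k * p) n := by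
  obtain ⟨m, hm⟩ := he
  rcases (show m = 2 ∨ 3 ≤ m by omega) with rfl | hm3
  · obtain rfl : p = 4 := by omega
    rcases (show k = 2 ∨ 3 ≤ k by omega) with rfl | hk
    · exact reach_small (by omega) (by omega)
    · exact reach_vertex (h₀ := 3) (x := 2) (h := 4) 2 (by omega) (by omega) (by omega)
        (by omega) (by omega) hn (by omega)
  · obtain ⟨g, rfl⟩ : ∃ g, p = g + 1 := ⟨p - 1, by omega⟩
    refine reach_flat g 2 2 2 (by omega) (by omega) (by omega) (by omega) hn ?_
    rw [hδ]
    ring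

/-- All Newton numbers outside the exceptional set are reached; `δ` is the difference to the Newton
number of the segment itself. -/
theorem reach_of_not_exceptional (p k n δ : ℕ) (hp : 2 ≤ p) (hk : 1 ≤ k) (hn1 : 1 ≤ n)
    (hδ : δ = 0 ∨ p - 1 ≤ δ) (hex : ¬ (Even p ∧ δ + 1 = 2 * p))
    (hn : n + δ = (p - 1) * (k * p - 1)) : Reach p (k * p) n := by
  have hkp : p ≤ k * p := Nat.le_mul_of_pos_left p hk
  have hz := hn
  zify [show 1 ≤ p by omega, show 1 ≤ k * p by omega] at hz
  rcases hp.eq_or_lt with rfl | hp3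
  · exact reach_small le_rfl (by omega)
  rcases hδ with rfl | hδ
  · exact reach_pair (by omega) (by omega) (by push_cast at hz ⊢; linarith)
  rcases hδ.eq_or_lt with rfl | hδ
  · refine (reach_pair (a := p) (b := k * p - 1) (by omega) (by omega) ?_).mono le_rfl (by omega)
    zify [show 1 ≤ p by omega, show 1 ≤ k * p by omega] at hz ⊢
    linarith
  rcases (show 2 * k + 1 ≤ p ∨ p ≤ 2 * k by omega) with hreg | hreg
  · by_cases h1 : δ + 3 ≤ (2 * k + 1) * (p - 1)
    · exact reach_of_step_left hp3 hk hreg (by omega) hex h1 hn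
    by_cases h2 : Odd p ∧ δ + 2 = (2 * k + 2) * (p - 1)
    · exact reach_of_step_left_odd hp3 hk hreg h2.1 hn1 h2.2 hn
    obtain ⟨r, rfl⟩ : ∃ r, p = r + 1 := ⟨p - 1, by omega⟩
    rw [Nat.add_sub_cancel] at h1 h2
    have e1 : (2 * k + 1) * r = 2 * (k * r) + r := by ring
    have e2 : (2 * k + 2) * r = 2 * (k * r) + 2 * r := by ring
    have hkr : r ≤ k * r := Nat.le_mul_of_pos_left r hk
    refine (reach_of_not_exceptional r k n (δ + 1 - 2 * (k * r)) (by omega) hk hn1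
      (Or.inr (by omega)) ?_ ?_).mono (by omega) (Nat.mul_le_mul_left k (by omega))
    · rintro ⟨he, h⟩
      exact h2 ⟨he.add_one, by omega⟩
    · zify [show 1 ≤ r by omega, show 1 ≤ k * r by omega, show 2 * (k * r) ≤ δ + 1 by omega]
      push_cast at hz
      linarith
  · by_cases h1 : δ < p * p
    · exact reach_of_step_down hp3 hreg (by omega) hex h1 hn
    by_cases h2 : Even p ∧ δ + 1 = p * p + p
    · exact reach_of_step_down_even hp3 hreg h2.1 h2.2 hn
    obtain ⟨m, rfl⟩ : ∃ m, k = m + 1 := ⟨k - 1, by omega⟩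
    have hm : 1 ≤ m := by omega
    have hmp : p ≤ m * p := Nat.le_mul_of_pos_left p hm
    have hpp : p ≤ p * p := Nat.le_mul_of_pos_left p (by omega)
    refine (reach_of_not_exceptional p m n (δ + p - p * p) hp hm hn1 (Or.inr (by omega)) ?_
      ?_).mono le_rfl (Nat.mul_le_mul_right p (by omega))
    · rintro ⟨he, h⟩
      exact h2 ⟨he, by omega⟩
    · zify [show 1 ≤ p by omega, show 1 ≤ m * p by omega, show p * p ≤ δ + p by omega]
      push_cast at hz
      linarith
termination_by p + k

end NewtonDiagram

theorem mainTheorem2 (p k : ℕ) (hp : 2 ≤ p) (hk : 1 ≤ k) :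
    ∃ N : ℕ, NewtonDiagram.newtonNumber (NewtonDiagram.tr p (k * p)) = ((N : ℝ) : EReal) ∧
      ∀ D : Set (ℝ × ℝ), NewtonDiagram.IsNewtonDiagram D → D ⊆ NewtonDiagram.tr p (k * p) →
        ∀ n : ℕ, 1 ≤ n → n ≤ N →
          ¬ ((N : ℤ) - ((p : ℤ) - 1) < (n : ℤ) ∧ n < N) →
          ¬ (Even p ∧ (n : ℤ) = (N : ℤ) - (2 * (p : ℤ) - 1)) →
          NewtonDiagram.IsAttainable D n := by
  have hkp : p ≤ k * p := Nat.le_mul_of_pos_left p hk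
  refine ⟨(p - 1) * (k * p - 1), ?_, fun D _ hD n hn1 hnN h1 h2 => ?_⟩
  · have hN : (((p - 1) * (k * p - 1) : ℕ) : ℝ) = ((p : ℝ) - 1) * (((k * p : ℕ) : ℝ) - 1) := by
      rw [Nat.cast_mul, Nat.cast_sub (by omega), Nat.cast_sub (by omega), Nat.cast_one]
    rw [NewtonDiagram.newtonNumber_tr (by omega) (by omega), hN]
  · refine (NewtonDiagram.reach_of_not_exceptional p k n ((p - 1) * (k * p - 1) - n) hp hk hn1 ?_ ?_
      (by omega)).isAttainable hD
    · omega
    · rintro ⟨he, h⟩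
      exact h2 ⟨he, by omega⟩
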